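/- Let $\mathbb F_q$ be a finite field with $q$ elements and characteristic $p$, let $n$ be a positive integer dividing $q-1$, and let $0<n_1,n_2,n_3<n$ be integers. Put $a_i=n_i\frac{q-1}{n}$ for $i=1,2,3$. Let $\epsilon_{q-1}$ be a primitive $(q-1)$-th root of unity, fix a prime of $\mathbb Z[\epsilon_{q-1}]$ above $p$ together with an identification of its residue field with $\mathbb F_q$, and let $\chi_q:\mathbb F_q\to\mathbb Z[\epsilon_{q-1}]$ be the Teichmüller character, i.e. the multiplicative character (with $\chi_q(0)=0$) such that $\chi_q(z)\equiv z$ modulo this prime. For $\alpha\in\mathbb F_q$ let $f=x^{n_1}(x-1)^{n_2}(x-\alpha)^{n_3}$ and consider the covering $y^n=f$ of $\mathbb P^1$ over $\mathbb F_q$, with function field $\mathbb F_q(x)(\sqrt[n]{f})$. Let $\chi_f$ be the character of its Galois group given by $\chi_f(\sigma)=\chi_q\big(\sigma(\sqrt[n]{f})/\sqrt[n]{f}\big)$. For a closed point $x$ of $\mathbb P^1$ outside $T=\{0,1,\alpha,\infty\}$ let $F_x$ be the Frobenius element at $x$, and put $\chi_f(F_x)=0$ for $x\in T$. Let $$L(\mathbb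 P^1_q,\chi_f,t)=\prod_{x\in|\mathbb P^1|}\bigl(1-\chi_f(F_x)\,t^{\deg x}\bigr)^{-1},$$ the product being over all closed points of $\mathbb P^1$ over $\mathbb F_q$, and let $c_1(q,\alpha)$ be the coefficient of $t$ in this power series. Suppose that $a_3=a_2$, $2(a_1+a_2)\equiv 0 \bmod (q-1)$, and $a_1+a_2\neq q-1$. If $\alpha^{\frac{q-1}{2}}=-1$ in $\mathbb F_q$, then $c_1(q,\alpha)=0$. (These hypotheses force $q$ to be odd, $\alpha\neq 0,1$, and the covering to be ramified at all four points of $T$.) -/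

import Mathlib

open Polynomial
open scoped NumberField

noncomputable section

namespace JacobiLSeries

/-! ### The Teichmüller character -/

/-- The cyclotomic field `ℚ(ε_{q-1})`, where `q = #F`. -/
abbrev CycField (F : Type*) [Fintype F] : Type :=
  CyclotomicField (Fintype.card F - 1) ℚ

/-- Let `π : ℤ[ε_{q-1}] → F` be the reduction modulo a prime above `p` with residue field `F`.
There is a multiplicative character `χ` of `F` with `χ(z) ≡ z` modulo that prime. -/
theorem exists_teichmuller {F : Type*} [Field F] [Fintype F] (π : 𝓞 (CycField F) →+* F) :
    ∃ χ : MulChar F (𝓞 (CycField F)), ∀ z : F, π (χ z) = z := by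
  classical
  have hcard : 1 < Fintype.card F := Fintype.one_lt_card
  have : NeZero (Fintype.card F - 1) := ⟨by omega⟩
  have : NeZero ((Fintype.card F - 1 : ℕ) : ℚ) := ⟨Nat.cast_ne_zero.2 (by omega)⟩
  have hcast : ((Fintype.card F - 1 : ℕ) : F) ≠ 0 := by
    rw [Nat.cast_sub hcard.le, FiniteField.cast_card_eq_zero]
    simp
  have : NeZero ((Fintype.card F - 1 : ℕ) : F) := ⟨hcast⟩
  obtain ⟨ζ₀, h0⟩ := (CyclotomicField.isCyclotomicExtension (Fintype.card F - 1)
    ℚ).exists_isPrimitiveRoot rfl (NeZero.ne _)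
  have h1 := h0.toInteger_isPrimitiveRoot
  have h2 : IsPrimitiveRoot (π h0.toInteger) (Fintype.card F - 1) := by
    rw [← isRoot_cyclotomic_iff]
    have := h1.isRoot_cyclotomic (NeZero.pos _)
    have h3 := this.map (f := π)
    rwa [map_cyclotomic] at h3
  obtain ⟨g, hg⟩ := IsCyclic.exists_generator (α := Fˣ)
  have hgpow : (g : F) ^ (Fintype.card F - 1) = 1 := FiniteField.pow_card_sub_one_eq_one _ g.ne_zero
  obtain ⟨i, -, hi⟩ := h2.eq_pow_of_pow_eq_one hgpow
  have hζ : (h0.toInteger ^ i) ^ (Fintype.card F - 1) = 1 := by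
    rw [← pow_mul, mul_comm, pow_mul, h1.pow_eq_one, one_pow]
  let ζ := Units.ofPowEqOne _ _ hζ (NeZero.ne _)
  have hζmem : ζ ∈ rootsOfUnity (Fintype.card Fˣ) (𝓞 (CycField F)) := by
    rw [mem_rootsOfUnity, Fintype.card_units]
    exact Units.pow_ofPowEqOne _ _
  refine ⟨MulChar.ofRootOfUnity hζmem hg, fun z => ?_⟩
  rcases eq_or_ne z 0 with rfl | hz
  · rw [MulChar.map_zero, map_zero]
  · obtain ⟨k, hk⟩ := (Submonoid.mem_powers_iff _ _).1
      ((mem_powers_iff_mem_zpowers).2 (hg (Units.mk0 z hz)))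
    have hzk : z = (g : F) ^ k := by
      rw [← Units.val_pow_eq_pow_val, hk, Units.val_mk0]
    rw [hzk, map_pow, map_pow, MulChar.ofRootOfUnity_spec]
    congr 1
    simpa [ζ] using hi

/-- The Teichmüller character `χ_q : F → ℤ[ε_{q-1}]`: the multiplicative character (zero at `0`)
with `χ_q(z) ≡ z` modulo the chosen prime of `ℤ[ε_{q-1}]`, the kernel of the reduction `π`. -/
def teichmuller {F : Type*} [Field F] [Fintype F] (π : 𝓞 (CycField F) →+* F) :
    MulChar F (𝓞 (CycField F)) :=
  (exists_teichmuller π).choose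

theorem teichmuller_spec {F : Type*} [Field F] [Fintype F] (π : 𝓞 (CycField F) →+* F) (z : F) :
    π (teichmuller π z) = z :=
  (exists_teichmuller π).choose_spec z

/-! ### Closed points of the projective line -/

/-- The closed points of `ℙ¹` over `F`: those of the affine line, given by the monic irreducible
polynomials, and the point at infinity. -/
inductive ClosedPoint (F : Type*) [Field F] : Type _
  | finite (P : F[X]) (monic : P.Monic) (irred : Irreducible P) : ClosedPoint F
  | infty : ClosedPoint F

namespace ClosedPoint

/-- The degree over `F` of the residue field of a closed point. -/
def degree {F : Type*} [Field F] : ClosedPoint F → ℕ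
  | finite P _ _ => P.natDegree
  | infty => 1

/-- There are finitely many closed points of bounded degree. -/
theorem finite_degree_le (F : Type*) [Field F] [Finite F] (k : ℕ) :
    {x : ClosedPoint F | x.degree ≤ k}.Finite := by
  classical
  let e : ClosedPoint F → Option (Fin (k + 1) → F) := fun x =>
    match x with
    | finite P _ _ => some fun i => P.coeff i
    | infty => none
  refine Set.Finite.of_injOn (f := e) (t := Set.univ) (fun _ _ => Set.mem_univ _) ?_
    Set.finite_univ
  rintro (⟨P, hP, iP⟩ | _) hx (⟨Q, hQ, iQ⟩ | _) hy h
  · have hPQ : P = Q := by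
      ext m
      by_cases hm : m < k + 1
      · exact congrFun (Option.some.inj h) ⟨m, hm⟩
      · have h1 : P.natDegree ≤ k := hx
        have h2 : Q.natDegree ≤ k := hy
        rw [coeff_eq_zero_of_natDegree_lt (by omega), coeff_eq_zero_of_natDegree_lt (by omega)]
    subst hPQ
    rfl
  · exact absurd h (by simp [e])
  · exact absurd h (by simp [e])
  · rfl

end ClosedPoint

/-! ### The cyclic covering `yⁿ = f` of the projective line -/

/-- The function field `F(x)(ⁿ√f)` of the covering `yⁿ = f`. (It is the splitting field of
`Yⁿ - f` over `F(x)`; in use `n` divides `q - 1`, so `F` contains the `n`-th roots of unity.) -/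
abbrev CoverField {F : Type*} [Field F] (n : ℕ) (f : F[X]) : Type _ :=
  (X ^ n - C (algebraMap F[X] (RatFunc F) f) : (RatFunc F)[X]).SplittingField

/-- The Galois group of the covering `yⁿ = f`. -/
abbrev CoverGroup {F : Type*} [Field F] (n : ℕ) (f : F[X]) : Type _ :=
  CoverField n f ≃ₐ[RatFunc F] CoverField n f

/-- The coordinate ring of the affine part of the covering curve: the integral closure of `F[x]`
in its function field. -/
abbrev CoverRing {F : Type*} [Field F] (n : ℕ) (f : F[X]) : Type _ :=
  integralClosure F[X] (CoverField n f)

/-- `σ` is a Frobenius element at the affine closed point `P`: for some prime `Q` of the covering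
curve above `P`, we have `σ b ≡ b ^ N mod Q` for all `b`, with `N` the cardinality of the residue
field of `P`. -/
def IsFrobeniusOver {F : Type*} [Field F] (n : ℕ) (f P : F[X]) (σ : CoverGroup n f) : Prop :=
  ∃ Q : Ideal (CoverRing n f), Q.IsPrime ∧ Q.under F[X] = Ideal.span {P} ∧ IsArithFrobAt F[X] σ Q

/-- The Frobenius element `F_x` at an affine closed point `P`. It exists always, and it is unique
if `P` is unramified, the Galois group being abelian. -/
def frobenius {F : Type*} [Field F] (n : ℕ) (f P : F[X]) : CoverGroup n f :=
  Classical.epsilon (IsFrobeniusOver n f P)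

/-- The `n`-th root of unity `μ ∈ F` with `σ(y) = μ y` for `y = ⁿ√f`. (It does not depend on
the choice of `y`.) -/
def kummer {F : Type*} [Field F] (n : ℕ) (f : F[X]) (σ : CoverGroup n f) : F :=
  Classical.epsilon fun μ : F => ∀ y : CoverField n f,
    y ^ n = algebraMap F[X] (CoverField n f) f →
      σ y = algebraMap (RatFunc F) (CoverField n f) (algebraMap F (RatFunc F) μ) * y

/-- The character `χ_f` of the Galois group: `χ_f(σ) = χ_q(σ(y)/y)` for `y = ⁿ√f`. -/
def galoisChar {F : Type*} [Field F] [Fintype F] (π : 𝓞 (CycField F) →+* F) (n : ℕ) (f : F[X])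
    (σ : CoverGroup n f) : 𝓞 (CycField F) :=
  teichmuller π (kummer n f σ)

/-- The value `χ_f(F_x)` at a closed point `x` of `ℙ¹`, zero at the ramification points. Here all
the zeros of `f` and the point at infinity are ramification points, that is, neither the order
of a geometric zero of `f` nor the degree of `f` is divisible by `n`. -/
def charAt {F : Type*} [Field F] [Fintype F] (π : 𝓞 (CycField F) →+* F) (n : ℕ) (f : F[X]) :
    ClosedPoint F → 𝓞 (CycField F)
  | .finite P _ _ => open Classical in
      if P ∣ f then 0 else galoisChar π n f (frobenius n f P)
  | .infty => 0

/-! ### The L-series -/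

/-- The Euler factor `(1 - χ_f(F_x) t^{deg x})⁻¹`. -/
def eulerFactor {F : Type*} [Field F] [Fintype F] (π : 𝓞 (CycField F) →+* F) (n : ℕ) (f : F[X])
    (x : ClosedPoint F) : PowerSeries (CycField F) :=
  (1 - PowerSeries.C (charAt π n f x : CycField F) * PowerSeries.X ^ x.degree)⁻¹

/-- The `L`-series `L(ℙ¹, χ_f, t) = ∏_x (1 - χ_f(F_x) t^{deg x})⁻¹`, a formal power series in `t`.
The factors at points of degree greater than `k` are `1` modulo `t^{k+1}`, so the coefficient of
`t^k` in the infinite product is the one in the finite product over the points of degree at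
most `k`. -/
def lSeries {F : Type*} [Field F] [Fintype F] (π : 𝓞 (CycField F) →+* F) (n : ℕ) (f : F[X]) :
    PowerSeries (CycField F) :=
  PowerSeries.mk fun k => PowerSeries.coeff k
    (∏ x ∈ (ClosedPoint.finite_degree_le F k).toFinset, eulerFactor π n f x)

/-- The polynomial `x^{n₁} (x-1)^{n₂} (x-α)^{n₃}`. -/
def curvePoly {F : Type*} [Field F] (n₁ n₂ n₃ : ℕ) (α : F) : F[X] :=
  X ^ n₁ * (X - 1) ^ n₂ * (X - C α) ^ n₃

end JacobiLSeries

end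

open JacobiLSeries

/-! Only points of degree one contribute to the coefficient of `t`, so it equals the sum of
`χ_f(F_x)` over rational points. By Kummer theory (`kummer_frobenius`) this is the character sum `∑
χ(c)^a₁ χ(c-1)^a₂ χ(c-α)^a₂` over `F` (`coeff_one_lSeries`). The involution `c ↦ α/c` exchanges `0`
with `∞` and `1` with `α`; since the exponents at `1` and `α` agree and `χ^(2(a₁+a₂))` is trivial on
nonzero elements, it multiplies the sum by `χ(α)^(a₁+a₂)` (`sum_mulChar_eq_zero`). The bounds on the
`aᵢ` make `a₁+a₂` an odd multiple of `(q-1)/2`, so this factor is `-1`. -/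

namespace JacobiLSeries

/-! ### Frobenius elements of the Kummer covering -/

section Cover

variable {F : Type*} [Field F] {n : ℕ} {f : F[X]}

theorem algebraMap_coverField_injective : Function.Injective (algebraMap F[X] (CoverField n f)) := by
  rw [IsScalarTower.algebraMap_eq F[X] (RatFunc F) (CoverField n f)]
  exact (algebraMap (RatFunc F) (CoverField n f)).injective.comp (IsFractionRing.injective _ _)

theorem exists_root (hn : n ≠ 0) :
    ∃ y : CoverField n f, y ^ n = algebraMap F[X] (CoverField n f) f := by
  obtain ⟨y, hy⟩ := (SplittingField.splits
    (X ^ n - C (algebraMap F[X] (RatFunc F) f) : (RatFunc F)[X])).exists_eval_eq_zero (by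
      rw [degree_map, degree_X_pow_sub_C (Nat.pos_of_ne_zero hn)]
      exact_mod_cast hn)
  refine ⟨y, ?_⟩
  rw [IsScalarTower.algebraMap_apply F[X] (RatFunc F) (CoverField n f)]
  simpa [sub_eq_zero] using hy

theorem isGalois_coverField (hn : (n : F) ≠ 0) (hf : f ≠ 0) :
    IsGalois (RatFunc F) (CoverField n f) := by
  refine IsGalois.of_separable_splitting_field
    (p := (X ^ n - C (algebraMap F[X] (RatFunc F) f) : (RatFunc F)[X]))
    (separable_X_pow_sub_C _ ?_ ?_)
  · rw [← map_natCast (algebraMap F (RatFunc F))]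
    exact (_root_.map_ne_zero _).2 hn
  · simpa using hf

theorem isInvariant_coverRing (hn : (n : F) ≠ 0) (hf : f ≠ 0) :
    Algebra.IsInvariant F[X] (CoverRing n f) (CoverGroup n f) := by
  have := isGalois_coverField hn hf
  refine ⟨fun b hb => ?_⟩
  have h1 : (b : CoverField n f) ∈ (⊥ : IntermediateField (RatFunc F) (CoverField n f)) := by
    rw [IsGalois.mem_bot_iff_fixed]
    exact fun σ => congrArg Subtype.val (hb σ)
  obtain ⟨k, hk⟩ := IntermediateField.mem_bot.1 h1
  have h2 : IsIntegral F[X] (algebraMap (RatFunc F) (CoverField n f) k) := hk ▸ b.2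
  rw [isIntegral_algebraMap_iff (algebraMap (RatFunc F) (CoverField n f)).injective] at h2
  obtain ⟨a, rfl⟩ := IsIntegrallyClosed.algebraMap_eq_of_integral h2
  refine ⟨a, Subtype.ext ?_⟩
  rw [← hk, ← IsScalarTower.algebraMap_apply]
  rfl

/-- Ensures that the choice in `frobenius` picks a genuine Frobenius element. Separability makes the
covering ring finite over `F[X]`, so residue fields above `c` are finite. -/
theorem exists_isFrobeniusOver [Finite F] (hn : (n : F) ≠ 0) (hf : f ≠ 0) (c : F) :
    ∃ σ, IsFrobeniusOver n f (X - C c) σ := by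
  have := isGalois_coverField hn hf
  have := isInvariant_coverRing hn hf
  have : Module.Finite F[X] (CoverRing n f) :=
    IsIntegralClosure.finite F[X] (RatFunc F) (CoverField n f) (CoverRing n f)
  have hP : (Ideal.span {X - C c}).IsPrime :=
    (Ideal.span_singleton_prime (X_sub_C_ne_zero c)).2 (prime_X_sub_C c)
  have : FaithfulSMul F[X] (CoverRing n f) := by
    rw [faithfulSMul_iff_algebraMap_injective]
    exact fun a b h => algebraMap_coverField_injective (congrArg Subtype.val h)
  obtain ⟨⟨Q, hQ, hQP⟩⟩ := Ideal.nonempty_primesOver (S := CoverRing n f) (Ideal.span {X - C c})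
  have : Finite (F[X] ⧸ Ideal.span {X - C c}) :=
    Finite.of_equiv F (quotientSpanXSubCAlgEquiv c).symm.toEquiv
  have : Finite (CoverRing n f ⧸ Q) := Module.finite_of_finite (F[X] ⧸ Ideal.span {X - C c})
  obtain ⟨σ, hσ⟩ := IsArithFrobAt.exists_of_isInvariant F[X] (CoverGroup n f) Q
  exact ⟨σ, Q, hQ, hQP.over.symm, hσ⟩

/-- A generator of `Fˣ` is a primitive `(q-1)`-th root of unity, and its powers exhaust those in any
extension field. -/
theorem exists_eq_algebraMap_of_pow_eq_one [Fintype F] (hn : n ∣ Fintype.card F - 1)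
    {ζ : CoverField n f} (hζ : ζ ^ n = 1) :
    ∃ μ : F, ζ = algebraMap (RatFunc F) (CoverField n f) (algebraMap F (RatFunc F) μ) := by
  obtain ⟨m, hm⟩ := hn
  obtain ⟨g, hg⟩ := IsCyclic.exists_generator (α := Fˣ)
  let φ := (algebraMap (RatFunc F) (CoverField n f)).comp (algebraMap F (RatFunc F))
  have hcard : orderOf g = Fintype.card F - 1 := by
    rw [orderOf_eq_card_of_forall_mem_zpowers hg, Nat.card_units, Nat.card_eq_fintype_card]
  have h1 : IsPrimitiveRoot (φ g) (Fintype.card F - 1) :=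
    by
    rw [← hcard]
    exact (IsPrimitiveRoot.coe_units_iff.2 (IsPrimitiveRoot.orderOf g)).map_of_injective φ.injective
  have : NeZero (Fintype.card F - 1) := ⟨hcard ▸ (orderOf_pos g).ne'⟩
  obtain ⟨i, -, hi⟩ := h1.eq_pow_of_pow_eq_one (ξ := ζ) (by rw [hm, pow_mul, hζ, one_pow])
  refine ⟨(g : F) ^ i, ?_⟩
  rw [← hi, ← map_pow]
  rfl

theorem kummer_spec [Fintype F] (hn : n ∣ Fintype.card F - 1) (hf : f ≠ 0) (σ : CoverGroup n f)
    {y : CoverField n f} (hy : y ^ n = algebraMap F[X] (CoverField n f) f) :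
    σ y = algebraMap (RatFunc F) (CoverField n f) (algebraMap F (RatFunc F) (kummer n f σ)) * y := by
  have hn0 : n ≠ 0 := by
    rintro rfl
    have := Fintype.one_lt_card (α := F)
    have := Nat.eq_zero_of_zero_dvd hn
    omega
  have hf' : algebraMap F[X] (CoverField n f) f ≠ 0 :=
    (map_ne_zero_iff _ algebraMap_coverField_injective).2 hf
  have hσf : σ (algebraMap F[X] (CoverField n f) f) = algebraMap F[X] (CoverField n f) f := by
    rw [IsScalarTower.algebraMap_apply F[X] (RatFunc F) (CoverField n f), σ.commutes]
  have hroot {z : CoverField n f} (hz : z ^ n = algebraMap F[X] (CoverField n f) f) : z ≠ 0 := by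
    rintro rfl
    exact hf' (by rw [← hz, zero_pow hn0])
  have hex : ∃ μ : F, ∀ z : CoverField n f, z ^ n = algebraMap F[X] (CoverField n f) f →
      σ z = algebraMap (RatFunc F) (CoverField n f) (algebraMap F (RatFunc F) μ) * z := by
    obtain ⟨μ, hμ⟩ := exists_eq_algebraMap_of_pow_eq_one hn (ζ := σ y / y) (by
      rw [div_pow, ← map_pow, hy, hσf, div_self hf'])
    refine ⟨μ, fun z hz => ?_⟩
    -- Two roots differ by a constant, which `σ` fixes, so `μ` serves for both.
    obtain ⟨ν, hν⟩ := exists_eq_algebraMap_of_pow_eq_one hn (ζ := z / y) (by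
      rw [div_pow, hz, hy, div_self hf'])
    rw [div_eq_iff (hroot hy)] at hμ hν
    rw [hν, map_mul, σ.commutes, hμ]
    ring
  exact Classical.epsilon_spec hex y hy

/-- At an unramified rational point `c`, the Frobenius element acts on `ⁿ√f` by
the power residue symbol `f(c)^((q-1)/n)`. -/
theorem kummer_frobenius [Fintype F] (hn : n ∣ Fintype.card F - 1) {c : F} (hc : f.eval c ≠ 0) :
    kummer n f (frobenius n f (X - C c)) = f.eval c ^ ((Fintype.card F - 1) / n) := by
  have hf : f ≠ 0 := by
    rintro rfl
    simp at hc
  have hq : 1 < Fintype.card F := Fintype.one_lt_card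
  have hn0 : n ≠ 0 := by
    rintro rfl
    exact absurd (Nat.eq_zero_of_zero_dvd hn) (by omega)
  have hnF : (n : F) ≠ 0 := by
    obtain ⟨m, hm⟩ := hn
    intro h
    have h1 : ((Fintype.card F - 1 : ℕ) : F) = 0 := by rw [hm, Nat.cast_mul, h, zero_mul]
    rw [Nat.cast_sub hq.le, FiniteField.cast_card_eq_zero] at h1
    simp at h1
  obtain ⟨Q, hQ, hQc, hfrob⟩ : IsFrobeniusOver n f (X - C c) (frobenius n f (X - C c)) :=
    Classical.epsilon_spec (exists_isFrobeniusOver hnF hf c)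
  have hmem {g : F[X]} : algebraMap F[X] (CoverRing n f) g ∈ Q ↔ g.eval c = 0 := by
    rw [← Ideal.mem_comap, ← Ideal.under_def, hQc, Ideal.mem_span_singleton, dvd_iff_isRoot,
      IsRoot.def]
  set σ := frobenius n f (X - C c)
  obtain ⟨y, hy⟩ := exists_root (f := f) hn0
  have hyint : IsIntegral F[X] y := by
    refine IsIntegral.of_pow (Nat.pos_of_ne_zero hn0) ?_
    rw [hy]
    exact isIntegral_algebraMap
  let z : CoverRing n f := ⟨y, hyint⟩
  have hz : z ^ n = algebraMap F[X] (CoverRing n f) f := Subtype.ext hy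
  have hzQ : z ∉ Q := fun h => hc (hmem.1 (hz ▸ Ideal.pow_mem_of_mem Q h n (Nat.pos_of_ne_zero hn0)))
  have hσz : σ • z = algebraMap F[X] (CoverRing n f) (C (kummer n f σ)) * z := by
    refine Subtype.ext ?_
    refine (kummer_spec hn hf σ hy).trans ?_
    congr 1
  have hcard : Nat.card (F[X] ⧸ Q.under F[X]) = Fintype.card F := by
    rw [hQc, ← Nat.card_eq_fintype_card]
    exact Nat.card_congr (quotientSpanXSubCAlgEquiv c).toEquiv
  have hzq : z ^ Fintype.card F =
      algebraMap F[X] (CoverRing n f) (f ^ ((Fintype.card F - 1) / n)) * z := by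
    rw [map_pow, ← hz, ← pow_mul, Nat.mul_div_cancel' hn, ← pow_succ, Nat.sub_add_cancel hq.le]
  -- Since `z ∉ Q`, it cancels from `μ z ≡ z^q = f^((q-1)/n) z` modulo `Q`; what remains lies in
  -- `F[X]`, where `Q` restricts to vanishing at `c`.
  have key := hfrob z
  rw [hcard, MulSemiringAction.toAlgHom_apply, hσz, hzq, ← sub_mul, ← map_sub] at key
  simpa [sub_eq_zero] using hmem.1 ((hQ.mem_or_mem key).resolve_right hzQ)

theorem galoisChar_frobenius [Fintype F] (π : 𝓞 (CycField F) →+* F) (hn : n ∣ Fintype.card F - 1)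
    {c : F} (hc : f.eval c ≠ 0) :
    galoisChar π n f (frobenius n f (X - C c)) =
      teichmuller π (f.eval c) ^ ((Fintype.card F - 1) / n) := by
  rw [galoisChar, kummer_frobenius hn hc, map_pow]

/-- Zeros of `f` need no exception, because `χ(0) = 0` and the exponent is positive. -/
theorem charAt_X_sub_C [Fintype F] (π : 𝓞 (CycField F) →+* F) (hn : n ∣ Fintype.card F - 1)
    (c : F) :
    charAt π n f (.finite (X - C c) (monic_X_sub_C c) (irreducible_X_sub_C c)) =
      teichmuller π (f.eval c) ^ ((Fintype.card F - 1) / n) := by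
  have hq : 1 < Fintype.card F := Fintype.one_lt_card
  have h0 : (Fintype.card F - 1) / n ≠ 0 :=
    (Nat.div_pos (Nat.le_of_dvd (by omega) hn) (Nat.pos_of_dvd_of_pos hn (by omega))).ne'
  by_cases hc : f.eval c = 0
  · rw [charAt, if_pos (dvd_iff_isRoot.2 hc), hc, MulChar.map_zero, zero_pow h0]
  · rw [charAt, if_neg (fun h => hc (dvd_iff_isRoot.1 h)), galoisChar_frobenius π hn hc]

end Cover

/-! ### The linear coefficient as a character sum -/

section LSeries

variable {F : Type*} [Field F] [Fintype F]

theorem _root_.PowerSeries.coeff_one_prod_of_constantCoeff_eq_one {ι R : Type*} [CommSemiring R]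
    (s : Finset ι) (f : ι → PowerSeries R) (hf : ∀ i ∈ s, PowerSeries.constantCoeff (f i) = 1) :
    PowerSeries.coeff 1 (∏ i ∈ s, f i) = ∑ i ∈ s, PowerSeries.coeff 1 (f i) := by
  classical
  induction s using Finset.induction_on with
  | empty => simp [PowerSeries.coeff_one]
  | insert i s hi ih =>
    have h1 : PowerSeries.constantCoeff (∏ j ∈ s, f j) = 1 := by
      rw [map_prod]
      exact Finset.prod_eq_one fun j hj => hf j (Finset.mem_insert_of_mem hj)
    rw [Finset.prod_insert hi, Finset.sum_insert hi, PowerSeries.coeff_one_mul, h1,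
      hf i (Finset.mem_insert_self i s), ih fun j hj => hf j (Finset.mem_insert_of_mem hj)]
    ring

theorem ClosedPoint.degree_pos {F : Type*} [Field F] (x : ClosedPoint F) : 0 < x.degree := by
  cases x with
  | finite P _ irred => exact irred.natDegree_pos
  | infty => exact Nat.one_pos

theorem constantCoeff_eulerFactor (π : 𝓞 (CycField F) →+* F) (n : ℕ) (f : F[X])
    (x : ClosedPoint F) : PowerSeries.constantCoeff (eulerFactor π n f x) = 1 := by
  simp [eulerFactor, x.degree_pos.ne']

theorem coeff_one_eulerFactor (π : 𝓞 (CycField F) →+* F) (n : ℕ) (f : F[X])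
    {x : ClosedPoint F} (hx : x.degree = 1) :
    PowerSeries.coeff 1 (eulerFactor π n f x) = charAt π n f x := by
  have h0 := constantCoeff_eulerFactor π n f x
  have h : (1 - PowerSeries.C (charAt π n f x : CycField F) * PowerSeries.X ^ x.degree) *
      eulerFactor π n f x = 1 :=
    PowerSeries.mul_inv_cancel _ (by simp [x.degree_pos.ne'])
  rw [hx, pow_one] at h
  have h1 := congrArg (PowerSeries.coeff 1) h
  rw [PowerSeries.coeff_one_mul, h0] at h1
  simpa [PowerSeries.coeff_one, sub_eq_zero, PowerSeries.coeff_C, add_comm, ← sub_eq_add_neg] using h1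

theorem coeff_one_lSeries (π : 𝓞 (CycField F) →+* F) {n : ℕ} (hn : n ∣ Fintype.card F - 1)
    (f : F[X]) :
    PowerSeries.coeff 1 (lSeries π n f) =
      ((∑ c : F, teichmuller π (f.eval c) ^ ((Fintype.card F - 1) / n) : 𝓞 (CycField F)) :
        CycField F) := by
  classical
  have hdeg {x : ClosedPoint F} :
      x ∈ (ClosedPoint.finite_degree_le F 1).toFinset ↔ x.degree ≤ 1 := by simp
  rw [lSeries, PowerSeries.coeff_mk, PowerSeries.coeff_one_prod_of_constantCoeff_eq_one _ _
    fun x _ => constantCoeff_eulerFactor π n f x, Finset.sum_congr rfl fun x hx =>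
    coeff_one_eulerFactor π n f (le_antisymm (hdeg.1 hx) x.degree_pos)]
  have hinj : Function.Injective fun c : F =>
      ClosedPoint.finite (X - C c) (monic_X_sub_C c) (irreducible_X_sub_C c) := by
    intro c d h
    simpa using h
  have hset : (ClosedPoint.finite_degree_le F 1).toFinset =
      insert .infty (Finset.univ.map ⟨_, hinj⟩) := by
    ext x
    rw [hdeg, Finset.mem_insert, Finset.mem_map]
    constructor
    · intro hx
      cases x with
      | infty => exact .inl rfl
      | finite P hP iP =>
        refine .inr ⟨-P.coeff 0, Finset.mem_univ _, ?_⟩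
        have : P = X + C (P.coeff 0) :=
          hP.eq_X_add_C (le_antisymm hx (ClosedPoint.degree_pos (.finite P hP iP)))
        simp only [Function.Embedding.coeFn_mk, ClosedPoint.finite.injEq]
        rw [C_neg, sub_neg_eq_add]
        exact this.symm
    · rintro (rfl | ⟨c, -, rfl⟩)
      · exact le_rfl
      · exact (natDegree_X_sub_C c).le
  rw [hset, Finset.sum_insert (by simp), Finset.sum_map]
  simp only [Function.Embedding.coeFn_mk, charAt_X_sub_C π hn]
  simp [charAt]

end LSeries

/-! ### The character sum and the conclusion -/

/-- The sum vanishes because the substitution `c ↦ α / c` multiplies it by `χ(α)^(a₁ + a₂)`. -/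
theorem sum_mulChar_eq_zero {F R : Type*} [Field F] [Fintype F] [CommRing R] [IsDomain R]
    (h2R : (2 : R) ≠ 0) (χ : MulChar F R) {a₁ a₂ : ℕ} (ha₁ : a₁ ≠ 0)
    (h : Fintype.card F - 1 ∣ 2 * (a₁ + a₂)) {α : F} (hα : α ≠ 0)
    (hχ : χ α ^ (a₁ + a₂) = -1) :
    ∑ c : F, χ c ^ a₁ * χ (c - 1) ^ a₂ * χ (c - α) ^ a₂ = 0 := by
  let S := ∑ c : F, χ c ^ a₁ * χ (c - 1) ^ a₂ * χ (c - α) ^ a₂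
  have hinv : Function.Involutive fun c : F => α / c := fun c => div_div_cancel₀ hα
  have hone {c : F} (hc : c ≠ 0) : χ c ^ (2 * (a₁ + a₂)) = 1 := by
    obtain ⟨m, hm⟩ := h
    rw [hm, ← map_pow, pow_mul, FiniteField.pow_card_sub_one_eq_one c hc, one_pow, map_one]
  have hS : S = -S := by
    calc S = ∑ c : F, χ (α / c) ^ a₁ * χ (α / c - 1) ^ a₂ * χ (α / c - α) ^ a₂ :=
          (Equiv.sum_comp hinv.toPerm _).symm
      _ = ∑ c : F, -(χ c ^ a₁ * χ (c - 1) ^ a₂ * χ (c - α) ^ a₂) := by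
          refine Finset.sum_congr rfl fun c _ => ?_
          rcases eq_or_ne c 0 with rfl | hc
          -- As `α / 0 = 0`, the involution fixes `0`, where both terms vanish.
          · simp [MulChar.map_zero χ, ha₁]
          have hχc : IsUnit (χ c) := (IsUnit.mk0 c hc).map χ
          have e1 : χ (α / c) * χ c = χ α := by rw [← map_mul, div_mul_cancel₀ _ hc]
          have e2 : χ (α / c - 1) * χ (α / c - α) * χ c ^ 2 = χ α * χ (c - 1) * χ (c - α) := by
            simp only [← map_mul, ← map_pow]
            congr 1
            field_simp
            ring
          -- This power clears the denominators on the left; on the right it completes `χ(c)^a₁` to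
          -- `χ(c)^(2(a₁+a₂)) = 1`.
          refine (hχc.pow (a₁ + 2 * a₂)).mul_right_cancel ?_
          calc _ = (χ (α / c) * χ c) ^ a₁ *
                (χ (α / c - 1) * χ (α / c - α) * χ c ^ 2) ^ a₂ := by ring
            _ = χ α ^ (a₁ + a₂) * (χ (c - 1) * χ (c - α)) ^ a₂ := by rw [e1, e2]; ring
            _ = -((χ (c - 1) * χ (c - α)) ^ a₂ * χ c ^ (2 * (a₁ + a₂))) := by
              rw [hχ, hone hc]; ring
            _ = _ := by ring
      _ = -S := Finset.sum_neg_distrib _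
  have : 2 * S = 0 := by linear_combination hS
  exact (mul_eq_zero.1 this).resolve_left h2R

theorem eval_curvePoly {F : Type*} [Field F] (n₁ n₂ n₃ : ℕ) (α c : F) :
    (curvePoly n₁ n₂ n₃ α).eval c = c ^ n₁ * (c - 1) ^ n₂ * (c - α) ^ n₃ := by
  simp [curvePoly]

theorem teichmuller_neg_one {F : Type*} [Field F] [Fintype F] (π : 𝓞 (CycField F) →+* F)
    (h : (-1 : F) ≠ 1) : teichmuller π (-1) = -1 := by
  refine (sq_eq_one_iff.1 ?_).resolve_left fun h1 => h ?_
  · rw [← map_pow, neg_one_sq, map_one]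
  · rw [← teichmuller_spec π (-1), h1, map_one]

end JacobiLSeries

theorem lemma5p2 {F : Type*} [Field F] [Fintype F]
    (π : 𝓞 (CycField F) →+* F)
    (n n₁ n₂ n₃ : ℕ) (hn : n ∣ Fintype.card F - 1)
    (hn₁ : 0 < n₁ ∧ n₁ < n) (hn₂ : 0 < n₂ ∧ n₂ < n) (hn₃ : 0 < n₃ ∧ n₃ < n)
    (a₁ a₂ a₃ : ℕ) (ha₁ : a₁ = n₁ * ((Fintype.card F - 1) / n))
    (ha₂ : a₂ = n₂ * ((Fintype.card F - 1) / n)) (ha₃ : a₃ = n₃ * ((Fintype.card F - 1) / n))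
    (h32 : a₃ = a₂) (h2 : Fintype.card F - 1 ∣ 2 * (a₁ + a₂))
    (hne : a₁ + a₂ ≠ Fintype.card F - 1)
    (α : F) (hα : α ^ ((Fintype.card F - 1) / 2) = -1) :
    PowerSeries.coeff 1 (lSeries π n (curvePoly n₁ n₂ n₃ α)) = 0 := by
  have hq : 1 < Fintype.card F := Fintype.one_lt_card
  have hm : 0 < (Fintype.card F - 1) / n :=
    Nat.div_pos (Nat.le_of_dvd (by omega) hn) (by omega)
  have hlt {k : ℕ} (hk : k < n) : k * ((Fintype.card F - 1) / n) < Fintype.card F - 1 :=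
    (Nat.mul_lt_mul_of_pos_right hk hm).trans_le (Nat.mul_div_le _ _)
  have l₁ : a₁ < Fintype.card F - 1 := ha₁ ▸ hlt hn₁.2
  have l₂ : a₂ < Fintype.card F - 1 := ha₂ ▸ hlt hn₂.2
  have p₁ : 0 < a₁ := ha₁ ▸ Nat.mul_pos hn₁.1 hm
  obtain ⟨k, hk⟩ := h2
  have hk4 : k < 4 := by
    by_contra! h4
    have := Nat.mul_le_mul_left (Fintype.card F - 1) h4
    omega
  -- Here `2(a₁+a₂) = k(q-1)` with `k < 4`; `k = 0` contradicts `a₁ > 0` and `k = 2` is `hne`,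
  -- leaving `k = 1` or `3`, both of which force `q-1` to be even.
  have hhalf : ∃ j, Odd j ∧ a₁ + a₂ = (Fintype.card F - 1) / 2 * j ∧
      Even (Fintype.card F - 1) := by
    interval_cases k
    · omega
    · exact ⟨1, odd_one, by omega, ⟨a₁ + a₂, by omega⟩⟩
    · omega
    · have h3 : 2 ∣ Fintype.card F - 1 := by omega
      exact ⟨3, by decide, by omega, even_iff_two_dvd.2 h3⟩
  obtain ⟨j, hj, hsum, heven⟩ := hhalf
  have hneg : (-1 : F) ≠ 1 := by
    refine Ring.neg_one_ne_one_of_char_ne_two fun h => ?_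
    have := FiniteField.even_card_of_char_two h
    rw [Nat.even_iff] at heven
    omega
  have hα0 : α ≠ 0 := by
    rintro rfl
    rw [zero_pow (by rintro h; rw [h] at hsum; omega)] at hα
    exact neg_ne_zero.2 one_ne_zero hα.symm
  have hχ : teichmuller π α ^ (a₁ + a₂) = -1 := by
    rw [hsum, ← map_pow, pow_mul, hα, hj.neg_one_pow, teichmuller_neg_one π hneg]
  rw [coeff_one_lSeries π hn, ← map_zero (algebraMap (𝓞 (CycField F)) (CycField F)),
    ← sum_mulChar_eq_zero two_ne_zero (teichmuller π) p₁.ne' ⟨k, hk⟩ hα0 hχ]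
  congr 1
  refine Finset.sum_congr rfl fun c _ => ?_
  rw [eval_curvePoly, map_mul, map_mul, map_pow, map_pow, map_pow, mul_pow, mul_pow, ← pow_mul,
    ← pow_mul, ← pow_mul, ← ha₁, ← ha₂, ← ha₃, h32]
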